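/- **Definitions.** A *contact algebra* is a pair $(B,C)$, where $B$ is a Boolean algebra (possibly with $0=1$; the complement is written $a^*$) and $C$ is a binary relation on $B$ such that, for all $a,b,c\in B$: - $a\neq 0$ implies $aCa$; - $aCb$ implies $a\neq 0$ and $b\neq 0$; - $aCb$ implies $bCa$; - $aC(b\vee c)$ if and only if $aCb$ or $aCc$. Write $a\ll_C b$ if not $aCb^*$. The contact algebra is *connected* if $aCa^*$ for every $a\in B\setminus\{0,1\}$, and *complete* if $B$ is a complete Boolean algebra. It is *normal* if, in addition, - whenever not $aCb$, there is $c\in B$ such that neither $aCc$ nor $bCc^*$ holds; - for every $a\neq 1$ there is $b\neq 0$ such that not $bCa$. A *local contact algebra* (LCA) is a triple $(B,\rho,\mathbb{B})$, where $(B,\rho)$ is a contact algebra and $\mathbb{B}$ is an ideal of $B$ (possibly $\mathbb{B}=B$) such that - if $a\in\mathbb{B}$, $c\in B$ and $a\ll_\rho c$, then $a\ll_\rho b\ll_\rho c$ for some $b\in\mathbb{B}$; - if $a\rho b$, then $a\rho(c\wedge b)$ for some $c\in\mathbb{B}$; - if $a\neq 0$, then $b\ll_\rho a$ for some $b\in\mathbb{B}\setminus\{0\}$.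 It is called complete (connected) if $(B,\rho)$ is complete (connected). For a complete Boolean homomorphism $\varphi:A\to B$ between complete Boolean algebras (a Boolean homomorphism preserving all joins and meets), let $\varphi_\Lambda:B\to A$, $\varphi_\Lambda(b)=\bigwedge\{a\in A : b\le\varphi(a)\}$, be its left adjoint. A map between topological spaces is *perfect* if it is continuous and closed and its point inverses are compact; open maps are continuous by convention; maps need not be onto. A space is *connected* if it is not the union of two disjoint non-empty open subsets; the empty space is thus connected. Consider the following four categories, with the usual composition of maps. - $\mathbf{OpPerLCCon}$: objects are the connected locally compact Hausdorff spaces; morphisms are the open perfect maps. - $\mathbf{DOpPerLCCon}$: objects are the connected complete local contact algebras; morphisms $(A,\rho,\mathbb{B})\to(B,\eta,\mathbb{B}')$ are the complete Boolean homomorphisms $\varphi:A\to B$ such that 1. for all $a,b\in A$, $\varphi(a)\,\eta\,\varphi(b)$ implies $a\rho b$; 2. $b\in\mathbb{B}'$ implies $\varphi_\Lambda(b)\in\mathbb{B}$; 3. $a\in\mathbb{B}$ implies $\varphi(a)\in\mathbb{B}'$; 4. for all $a\in A$ and $b\in\mathbb{B}'$, $\varphi_\Lambda(b)\,\rho\,a$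 implies $b\,\eta\,\varphi(a)$. - $\mathbf{OpCCon}$: objects are the connected compact Hausdorff spaces; morphisms are the open maps. - $\mathbf{DOpCCon}$: objects are the connected complete normal contact algebras; morphisms $(A,C)\to(B,C')$ are the complete Boolean homomorphisms $\varphi:A\to B$ such that 1. for all $a,b\in A$, $\varphi(a)C'\varphi(b)$ implies $aCb$; 2. for all $a\in A$ and $b\in B$, $aC\varphi_\Lambda(b)$ implies $\varphi(a)C'b$. **Theorem.** The categories $\mathbf{OpPerLCCon}$ and $\mathbf{DOpPerLCCon}$ are dually equivalent; in particular, the categories $\mathbf{OpCCon}$ and $\mathbf{DOpCCon}$ are dually equivalent. -/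

import Mathlib

open CategoryTheory

universe u

/-! ### Contact algebras -/

/-- `(B, C)` is a contact algebra. The algebra `B` may be trivial. -/
structure IsContactAlgebra {B : Type u} [BooleanAlgebra B] (C : B → B → Prop) : Prop where
  refl_of_ne_bot : ∀ a, a ≠ ⊥ → C a a
  ne_bot : ∀ a b, C a b → a ≠ ⊥ ∧ b ≠ ⊥
  symm : ∀ a b, C a b → C b a
  sup_right : ∀ a b c, C a (b ⊔ c) ↔ C a b ∨ C a c

/-- Non-tangential inclusion `a ≪ b` with respect to `C`. -/
def NonTangential {B : Type u} [BooleanAlgebra B] (C : B → B → Prop) (a b : B) : Prop :=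
  ¬ C a bᶜ

/-- The connectedness axiom for a contact algebra; a trivial algebra satisfies it. -/
def IsConnectedContact {B : Type u} [BooleanAlgebra B] (C : B → B → Prop) : Prop :=
  ∀ a : B, a ≠ ⊥ → a ≠ ⊤ → C a aᶜ

/-- `(B, C)` is a normal contact algebra. -/
structure IsNormalContactAlgebra {B : Type u} [BooleanAlgebra B] (C : B → B → Prop) : Prop
    extends IsContactAlgebra C where
  separation : ∀ a b, ¬ C a b → ∃ c, ¬ C a c ∧ ¬ C b cᶜ
  extensional : ∀ a, a ≠ ⊤ → ∃ b, b ≠ ⊥ ∧ ¬ C b a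

/-- `(B, ρ, I)` is a local contact algebra; `I` is the (possibly non-proper) ideal of bounded
elements. -/
structure IsLocalContactAlgebra {B : Type u} [BooleanAlgebra B] (ρ : B → B → Prop)
    (I : Order.Ideal B) : Prop extends IsContactAlgebra ρ where
  interpolate : ∀ a ∈ I, ∀ c, NonTangential ρ a c →
    ∃ b ∈ I, NonTangential ρ a b ∧ NonTangential ρ b c
  bounded_witness : ∀ a b, ρ a b → ∃ c ∈ I, ρ a (c ⊓ b)
  bounded_below : ∀ a, a ≠ ⊥ → ∃ b ∈ I, b ≠ ⊥ ∧ NonTangential ρ b a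

/-- The left adjoint `φ_Λ` of a complete Boolean homomorphism `φ`. Between complete Boolean
algebras, the complete Boolean homomorphisms are exactly the maps preserving all joins and all
meets (the complement is then preserved automatically). -/
def lambdaAdj {A B : Type u} [CompleteBooleanAlgebra A] [CompleteBooleanAlgebra B]
    (φ : CompleteLatticeHom A B) (b : B) : A :=
  sInf {a | b ≤ φ a}

theorem gc_lambdaAdj {A B : Type u} [CompleteBooleanAlgebra A] [CompleteBooleanAlgebra B]
    (φ : CompleteLatticeHom A B) : GaloisConnection (lambdaAdj φ) φ := by
  intro b a
  constructor
  · intro h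
    have h1 : b ≤ φ (lambdaAdj φ b) := by
      unfold lambdaAdj
      rw [map_sInf]
      exact le_sInf (by rintro _ ⟨x, hx, rfl⟩; exact hx)
    exact h1.trans (OrderHomClass.mono φ h)
  · intro h
    exact sInf_le h

theorem lambdaAdj_id {A : Type u} [CompleteBooleanAlgebra A] (a : A) :
    lambdaAdj (CompleteLatticeHom.id A) a = a :=
  le_antisymm ((gc_lambdaAdj (CompleteLatticeHom.id A)).l_le le_rfl)
    ((gc_lambdaAdj (CompleteLatticeHom.id A)).le_u_l a)

theorem lambdaAdj_comp {A B D : Type u} [CompleteBooleanAlgebra A] [CompleteBooleanAlgebra B]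
    [CompleteBooleanAlgebra D] (ψ : CompleteLatticeHom B D) (φ : CompleteLatticeHom A B) (d : D) :
    lambdaAdj (ψ.comp φ) d = lambdaAdj φ (lambdaAdj ψ d) :=
  (gc_lambdaAdj (ψ.comp φ)).l_unique ((gc_lambdaAdj ψ).compose (gc_lambdaAdj φ)) (fun _ => rfl)

/-! ### Complete local contact algebras: the category `DOpPerLC` -/

/-- The objects of `DOpPerLC`: complete local contact algebras. -/
structure DOpPerLC : Type (u + 1) where
  carrier : Type u
  [str : CompleteBooleanAlgebra carrier]
  rel : carrier → carrier → Prop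
  bounded : Order.Ideal carrier
  isLocalContactAlgebra : IsLocalContactAlgebra rel bounded

instance : CoeSort DOpPerLC.{u} (Type u) := ⟨DOpPerLC.carrier⟩

attribute [instance] DOpPerLC.str

/-- The morphisms of `DOpPerLC`: complete Boolean homomorphisms `φ : A → B` reflecting the contact
relation, such that `φ_Λ` and `φ` preserve boundedness, and which satisfy the openness
condition. -/
structure DOpPerLC.Hom (A B : DOpPerLC.{u}) : Type u where
  toHom : CompleteLatticeHom A B
  rel_of_rel_map : ∀ a b : A, B.rel (toHom a) (toHom b) → A.rel a b
  bounded_lambdaAdj : ∀ b ∈ B.bounded, lambdaAdj toHom b ∈ A.bounded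
  bounded_map : ∀ a ∈ A.bounded, toHom a ∈ B.bounded
  openness : ∀ a : A, ∀ b ∈ B.bounded, A.rel (lambdaAdj toHom b) a → B.rel b (toHom a)

instance : Category.{u} DOpPerLC.{u} where
  Hom := DOpPerLC.Hom
  id A :=
    { toHom := CompleteLatticeHom.id A
      rel_of_rel_map := fun _ _ h => h
      bounded_lambdaAdj := fun b hb => by rwa [lambdaAdj_id]
      bounded_map := fun _ h => h
      openness := fun a b _ h => by rwa [lambdaAdj_id] at h }
  comp f g :=
    { toHom := g.toHom.comp f.toHom
      rel_of_rel_map := fun a b h => f.rel_of_rel_map a b (g.rel_of_rel_map _ _ h)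
      bounded_lambdaAdj := fun b hb => by
        rw [lambdaAdj_comp]
        exact f.bounded_lambdaAdj _ (g.bounded_lambdaAdj b hb)
      bounded_map := fun a h => g.bounded_map _ (f.bounded_map a h)
      openness := fun a b hb h => by
        rw [lambdaAdj_comp] at h
        exact g.openness _ b hb (f.openness a _ (g.bounded_lambdaAdj b hb) h) }

/-- The full subcategory of `DOpPerLC` on the connected complete local contact algebras. -/
abbrev DOpPerLCCon : Type (u + 1) :=
  ObjectProperty.FullSubcategory (fun A : DOpPerLC.{u} => IsConnectedContact A.rel)

/-! ### Complete normal contact algebras: the category `DOpC` -/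

/-- The objects of `DOpC`: complete normal contact algebras. -/
structure DOpC : Type (u + 1) where
  carrier : Type u
  [str : CompleteBooleanAlgebra carrier]
  rel : carrier → carrier → Prop
  isNormalContactAlgebra : IsNormalContactAlgebra rel

instance : CoeSort DOpC.{u} (Type u) := ⟨DOpC.carrier⟩

attribute [instance] DOpC.str

/-- The morphisms of `DOpC`: complete Boolean homomorphisms reflecting the contact relation and
satisfying the openness condition. -/
structure DOpC.Hom (A B : DOpC.{u}) : Type u where
  toHom : CompleteLatticeHom A B
  rel_of_rel_map : ∀ a b : A, B.rel (toHom a) (toHom b) → A.rel a b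
  openness : ∀ (a : A) (b : B), A.rel a (lambdaAdj toHom b) → B.rel (toHom a) b

instance : Category.{u} DOpC.{u} where
  Hom := DOpC.Hom
  id A :=
    { toHom := CompleteLatticeHom.id A
      rel_of_rel_map := fun _ _ h => h
      openness := fun a b h => by rwa [lambdaAdj_id] at h }
  comp f g :=
    { toHom := g.toHom.comp f.toHom
      rel_of_rel_map := fun a b h => f.rel_of_rel_map a b (g.rel_of_rel_map _ _ h)
      openness := fun a b h => by
        rw [lambdaAdj_comp] at h
        exact g.openness _ b (f.openness a _ h) }

/-- The full subcategory of `DOpC` on the connected complete normal contact algebras. -/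
abbrev DOpCCon : Type (u + 1) :=
  ObjectProperty.FullSubcategory (fun A : DOpC.{u} => IsConnectedContact A.rel)

/-! ### Locally compact Hausdorff spaces: the category `OpPerLC` -/

/-- A perfect map: continuous, closed, with compact point inverses; not necessarily onto. -/
structure IsPerfectMap {X Y : Type u} [TopologicalSpace X] [TopologicalSpace Y] (f : X → Y) :
    Prop where
  continuous : Continuous f
  isClosedMap : IsClosedMap f
  isCompact_fiber : ∀ y, IsCompact (f ⁻¹' {y})

theorem isPerfectMap_iff_isProperMap {X Y : Type u} [TopologicalSpace X] [TopologicalSpace Y]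
    {f : X → Y} : IsPerfectMap f ↔ IsProperMap f :=
  ⟨fun h => isProperMap_iff_isClosedMap_and_compact_fibers.2 ⟨h.1, h.2, h.3⟩,
    fun h => ⟨h.continuous, h.isClosedMap, fun _ => h.isCompact_preimage isCompact_singleton⟩⟩

/-- The objects of `OpPerLC`: locally compact Hausdorff spaces (the empty space included). -/
structure OpPerLC : Type (u + 1) where
  carrier : Type u
  [top : TopologicalSpace carrier]
  [t2 : T2Space carrier]
  [locallyCompact : LocallyCompactSpace carrier]

instance : CoeSort OpPerLC.{u} (Type u) := ⟨OpPerLC.carrier⟩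

attribute [instance] OpPerLC.top OpPerLC.t2 OpPerLC.locallyCompact

/-- The morphisms of `OpPerLC`: open perfect maps. -/
structure OpPerLC.Hom (X Y : OpPerLC.{u}) : Type u where
  toFun : X → Y
  isOpenMap : IsOpenMap toFun
  isPerfectMap : IsPerfectMap toFun

instance : Category.{u} OpPerLC.{u} where
  Hom := OpPerLC.Hom
  id X := ⟨_root_.id, IsOpenMap.id, isPerfectMap_iff_isProperMap.2 isProperMap_id⟩
  comp f g := ⟨g.toFun ∘ f.toFun, g.isOpenMap.comp f.isOpenMap,
    isPerfectMap_iff_isProperMap.2 ((isPerfectMap_iff_isProperMap.1 g.isPerfectMap).comp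
      (isPerfectMap_iff_isProperMap.1 f.isPerfectMap))⟩

/-- The full subcategory of `OpPerLC` on the connected spaces. A space is connected if it is not
the union of two disjoint nonempty open subsets; in particular the empty space is connected. -/
abbrev OpPerLCCon : Type (u + 1) :=
  ObjectProperty.FullSubcategory (fun X : OpPerLC.{u} => PreconnectedSpace X)

/-! ### Compact Hausdorff spaces: the category `OpC` -/

/-- The objects of `OpC`: compact Hausdorff spaces (the empty space included). -/
structure OpC : Type (u + 1) where
  carrier : Type u
  [top : TopologicalSpace carrier]
  [t2 : T2Space carrier]
  [compact : CompactSpace carrier]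

instance : CoeSort OpC.{u} (Type u) := ⟨OpC.carrier⟩

attribute [instance] OpC.top OpC.t2 OpC.compact

/-- The morphisms of `OpC`: continuous open maps. -/
structure OpC.Hom (X Y : OpC.{u}) : Type u where
  toFun : X → Y
  continuous : Continuous toFun
  isOpenMap : IsOpenMap toFun

instance : Category.{u} OpC.{u} where
  Hom := OpC.Hom
  id X := ⟨_root_.id, continuous_id, IsOpenMap.id⟩
  comp f g := ⟨g.toFun ∘ f.toFun, g.continuous.comp f.continuous, g.isOpenMap.comp f.isOpenMap⟩

/-- The full subcategory of `OpC` on the connected spaces (the empty space included). -/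
abbrev OpCCon : Type (u + 1) :=
  ObjectProperty.FullSubcategory (fun X : OpC.{u} => PreconnectedSpace X)

/-! A space `X` is sent to the Boolean algebra of its regular open sets, where two sets touch if
their closures meet and an element is bounded if its closure is compact. An open continuous map
pulls regular open sets back to regular open sets. This gives contravariant functors from locally
compact and from compact Hausdorff spaces, and both dualities follow by checking that these are
fully faithful and essentially surjective, and that connected objects correspond.

Faithfulness holds because regular open sets separate points. For fullness
(`exists_isOpenMap_isProperMap`), a homomorphism `φ` determines a point map: `x` goes to the cluster
point of the filter of all `U` with `x` in `φ U`. Boundedness of `lambdaAdj φ` makes this cluster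
point exist, reflection of contact controls closures, and the openness condition makes the map open
with `φ` as its preimage map.

For essential surjectivity, the points of the dual space are the round prime filters with a bounded
member (`ContactEnd`). The prime ideal theorem supplies enough of them, so that `regularOpensIso` is
an order isomorphism matching contact and boundedness. The compact case is the local one with every
element bounded. -/

open Set Topology TopologicalSpace Opposite

/-! ### The complete Boolean algebra of regular open sets -/

/-- The regular open subsets of a space. -/
def RegularOpens (X : Type u) [TopologicalSpace X] : Type u :=
  Heyting.Regular (Opens X)

namespace RegularOpens

variable {X : Type u} [TopologicalSpace X]

instance : CompleteBooleanAlgebra (RegularOpens X) :=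
  { (inferInstance : BooleanAlgebra (Heyting.Regular (Opens X))),
    (Heyting.Regular.gi (α := Opens X)).liftCompleteLattice with }

/-- The underlying set of a regular open set. -/
def set (U : RegularOpens X) : Set X := ((Heyting.Regular.val U : Opens X) : Set X)

theorem isOpen_set (U : RegularOpens X) : IsOpen U.set := (Heyting.Regular.val (α := Opens X) U).isOpen

theorem set_subset_set {U V : RegularOpens X} : U.set ⊆ V.set ↔ U ≤ V := Iff.rfl

theorem set_injective : Function.Injective (set : RegularOpens X → Set X) := fun _ _ h =>
  le_antisymm (set_subset_set.1 h.subset) (set_subset_set.1 h.superset)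

theorem set_inf (U V : RegularOpens X) : (U ⊓ V).set = U.set ∩ V.set := rfl

theorem set_bot : (⊥ : RegularOpens X).set = ∅ := rfl

theorem set_top : (⊤ : RegularOpens X).set = univ := rfl

theorem set_compl (U : RegularOpens X) : Uᶜ.set = (closure U.set)ᶜ := by
  have : Uᶜ.set = interior U.setᶜ := Opens.coe_compl_eq_interior_compl
  rw [this, interior_compl]

theorem closure_set_compl (U : RegularOpens X) : closure Uᶜ.set = U.setᶜ := by
  have h : closure Uᶜ.set = (Uᶜᶜ.set)ᶜ := by rw [set_compl Uᶜ, compl_compl]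
  rw [h, compl_compl]

theorem interior_closure_set (U : RegularOpens X) : interior (closure U.set) = U.set := by
  have h := set_compl Uᶜ
  rw [compl_compl, set_compl, closure_compl, compl_compl] at h
  exact h.symm

/-- The regularization `int cl W` of an arbitrary set. -/
def reg (W : Set X) : RegularOpens X :=
  ⟨⟨interior (closure W), isOpen_interior⟩, by
    apply SetLike.coe_injective
    rw [Opens.coe_compl_eq_interior_compl, Opens.coe_compl_eq_interior_compl]
    simp only [Opens.coe_mk, interior_compl, compl_compl]
    exact subset_antisymm (interior_mono (closure_minimal interior_subset isClosed_closure))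
      (interior_maximal subset_closure isOpen_interior)⟩

theorem set_reg (W : Set X) : (reg W).set = interior (closure W) := rfl

theorem subset_reg {W : Set X} (hW : IsOpen W) : W ⊆ (reg W).set :=
  interior_maximal subset_closure hW

theorem reg_set_le {W : Set X} {U : RegularOpens X} (h : W ⊆ U.set) : (reg W).set ⊆ U.set := by
  rw [← interior_closure_set U]
  exact interior_mono (closure_mono h)

theorem closure_reg_subset (W : Set X) : closure (reg W).set ⊆ closure W :=
  closure_minimal interior_subset isClosed_closure

theorem ne_bot_iff {U : RegularOpens X} : U ≠ ⊥ ↔ U.set.Nonempty := by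
  rw [nonempty_iff_ne_empty, ← set_bot, set_injective.ne_iff]

theorem closure_set_sup (U V : RegularOpens X) :
    closure (U ⊔ V).set = closure U.set ∪ closure V.set := by
  apply subset_antisymm
  · have h : U ⊔ V = (Uᶜ ⊓ Vᶜ)ᶜ := by simp
    rw [h, closure_set_compl, set_inf, set_compl, set_compl, ← compl_union, compl_compl]
  · exact union_subset (closure_mono (set_subset_set.2 le_sup_left))
      (closure_mono (set_subset_set.2 le_sup_right))

theorem set_sSup (S : Set (RegularOpens X)) :
    (sSup S).set = interior (closure (⋃ U ∈ S, U.set)) := by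
  apply subset_antisymm
  · have : sSup S ≤ reg (⋃ U ∈ S, U.set) := sSup_le fun U hU => set_subset_set.1
      ((subset_biUnion_of_mem hU).trans (subset_reg (isOpen_biUnion fun V _ => V.isOpen_set)))
    exact this
  · exact reg_set_le (iUnion₂_subset fun U hU => set_subset_set.2 (le_sSup hU))

/-- Two regular open sets are in contact if their closures meet. -/
def Contact (U V : RegularOpens X) : Prop := (closure U.set ∩ closure V.set).Nonempty

theorem not_contact {U V : RegularOpens X} :
    ¬ Contact U V ↔ Disjoint (closure U.set) (closure V.set) :=
  not_nonempty_iff_eq_empty.trans disjoint_iff_inter_eq_empty.symm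

theorem nonTangential_contact {U V : RegularOpens X} :
    NonTangential Contact U V ↔ closure U.set ⊆ V.set := by
  rw [NonTangential, not_contact, closure_set_compl, disjoint_compl_right_iff_subset]

theorem isContactAlgebra : IsContactAlgebra (Contact (X := X)) where
  refl_of_ne_bot U hU := by
    obtain ⟨x, hx⟩ := ne_bot_iff.1 hU
    exact ⟨x, subset_closure hx, subset_closure hx⟩
  ne_bot U V := by
    rintro ⟨x, hx, hy⟩
    exact ⟨ne_bot_iff.2 (closure_nonempty_iff.1 ⟨x, hx⟩),
      ne_bot_iff.2 (closure_nonempty_iff.1 ⟨x, hy⟩)⟩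
  symm U V h := by rwa [Contact, inter_comm]
  sup_right U V W := by
    rw [Contact, closure_set_sup, inter_union_distrib_left, union_nonempty]
    rfl

theorem exists_between [T2Space X] [LocallyCompactSpace X] {K W : Set X} (hK : IsCompact K)
    (hW : IsOpen W) (h : K ⊆ W) :
    ∃ V : RegularOpens X, K ⊆ V.set ∧ closure V.set ⊆ W ∧ IsCompact (closure V.set) := by
  obtain ⟨L, hL, hKL, hLW⟩ := exists_compact_between hK hW h
  have hcl : closure (reg (interior L)).set ⊆ L :=
    (closure_reg_subset _).trans (closure_minimal interior_subset hL.isClosed)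
  exact ⟨reg (interior L), hKL.trans (subset_reg isOpen_interior), hcl.trans hLW,
    hL.of_isClosed_subset isClosed_closure hcl⟩

theorem exists_mem_closure_subset [T2Space X] [LocallyCompactSpace X] {x : X} {W : Set X}
    (hW : IsOpen W) (hx : x ∈ W) :
    ∃ V : RegularOpens X, x ∈ V.set ∧ closure V.set ⊆ W ∧ IsCompact (closure V.set) := by
  simpa using exists_between isCompact_singleton hW (singleton_subset_iff.2 hx)

variable (X) in
/-- The ideal of regular open sets with compact closure. -/
def compacts : Order.Ideal (RegularOpens X) where
  carrier := {U | IsCompact (closure U.set)}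
  lower' U V hVU hU := hU.of_isClosed_subset isClosed_closure (closure_mono hVU)
  nonempty' := ⟨⊥, by simp [set_bot]⟩
  directed' U hU V hV :=
    ⟨U ⊔ V, by simpa [closure_set_sup] using hU.union hV, le_sup_left, le_sup_right⟩

theorem mem_compacts {U : RegularOpens X} : U ∈ compacts X ↔ IsCompact (closure U.set) := Iff.rfl

theorem compacts_eq_top [CompactSpace X] : compacts X = ⊤ :=
  top_le_iff.1 fun _ _ => isClosed_closure.isCompact

/-- Each of the three local axioms is an instance of squeezing an open set with compact closure
between a compact set and an open neighbourhood of it. -/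
theorem isLocalContactAlgebra [T2Space X] [LocallyCompactSpace X] :
    IsLocalContactAlgebra (Contact (X := X)) (compacts X) where
  toIsContactAlgebra := isContactAlgebra
  interpolate U hU W h := by
    obtain ⟨V, h1, h2, h3⟩ := exists_between hU W.isOpen_set (nonTangential_contact.1 h)
    exact ⟨V, h3, nonTangential_contact.2 h1, nonTangential_contact.2 h2⟩
  bounded_witness U V := by
    rintro ⟨x, hx, hy⟩
    obtain ⟨W, h1, -, h3⟩ := exists_mem_closure_subset isOpen_univ (mem_univ x)
    exact ⟨W, h3, x, hx, W.isOpen_set.inter_closure ⟨h1, hy⟩⟩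
  bounded_below U hU := by
    obtain ⟨x, hx⟩ := ne_bot_iff.1 hU
    obtain ⟨V, h1, h2, h3⟩ := exists_mem_closure_subset U.isOpen_set hx
    exact ⟨V, h3, ne_bot_iff.2 ⟨x, h1⟩, nonTangential_contact.2 h2⟩

/-- A regular open set fails to touch its complement exactly when it is clopen, and every clopen set
is regular open. -/
theorem isConnectedContact_iff :
    IsConnectedContact (Contact (X := X)) ↔ PreconnectedSpace X := by
  rw [preconnectedSpace_iff_clopen]
  constructor
  · intro h s hs
    have hset : (reg s).set = s := by rw [set_reg, hs.1.closure_eq, hs.2.interior_eq]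
    by_contra! hne
    obtain ⟨x, hx, hy⟩ := h (reg s) (ne_bot_iff.2 (hset.symm ▸ hne.1))
      (fun ht => hne.2 (by rw [← hset, ht, set_top]))
    rw [closure_set_compl, hset] at hy
    rw [hset, hs.1.closure_eq] at hx
    exact hy hx
  · intro h U hbot htop
    by_contra hU
    have hcl : closure U.set ⊆ U.set := by
      rw [not_contact, closure_set_compl, disjoint_compl_right_iff_subset] at hU
      exact hU
    rcases h U.set ⟨isClosed_of_closure_subset hcl, U.isOpen_set⟩ with h | h
    · exact hbot (set_injective h)
    · exact htop (set_injective h)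

end RegularOpens

/-! ### Regular open sets and open maps -/

namespace RegularOpens

variable {X Y : Type u} [TopologicalSpace X] [TopologicalSpace Y]

section Preimage

variable {f : X → Y} (ho : IsOpenMap f) (hc : Continuous f)

include ho hc

/-- Preimage under an open continuous map commutes with both closure and interior, so no
regularization is needed. -/
theorem set_reg_preimage (U : RegularOpens Y) : (reg (f ⁻¹' U.set)).set = f ⁻¹' U.set := by
  rw [set_reg, ← ho.preimage_closure_eq_closure_preimage hc,
    ← ho.preimage_interior_eq_interior_preimage hc, interior_closure_set]

theorem reg_preimage_compl (U : RegularOpens Y) :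
    reg (f ⁻¹' Uᶜ.set) = (reg (f ⁻¹' U.set))ᶜ := by
  apply set_injective
  rw [set_reg_preimage ho hc, set_compl, set_compl, set_reg_preimage ho hc,
    ← ho.preimage_closure_eq_closure_preimage hc, preimage_compl]

theorem reg_preimage_sSup (S : Set (RegularOpens Y)) :
    reg (f ⁻¹' (sSup S).set) = sSup ((fun U => reg (f ⁻¹' U.set)) '' S) := by
  apply set_injective
  rw [set_reg_preimage ho hc, set_sSup, set_sSup, ho.preimage_interior_eq_interior_preimage hc,
    ho.preimage_closure_eq_closure_preimage hc, preimage_iUnion₂, biUnion_image]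
  simp only [set_reg_preimage ho hc]

theorem reg_preimage_sInf (S : Set (RegularOpens Y)) :
    reg (f ⁻¹' (sInf S).set) = sInf ((fun U => reg (f ⁻¹' U.set)) '' S) := by
  apply compl_injective
  rw [← reg_preimage_compl ho hc, compl_sInf', reg_preimage_sSup ho hc, compl_sInf', image_image,
    image_image]
  simp only [reg_preimage_compl ho hc]

omit ho hc in
/-- The complete Boolean homomorphism induced by a continuous open map. -/
def preimageHom (f : X → Y) (ho : IsOpenMap f) (hc : Continuous f) :
    CompleteLatticeHom (RegularOpens Y) (RegularOpens X) where
  toFun U := reg (f ⁻¹' U.set)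
  map_sInf' := reg_preimage_sInf ho hc
  map_sSup' := reg_preimage_sSup ho hc

theorem set_preimageHom (U : RegularOpens Y) : (preimageHom f ho hc U).set = f ⁻¹' U.set :=
  set_reg_preimage ho hc U

theorem closure_preimageHom (U : RegularOpens Y) :
    closure (preimageHom f ho hc U).set = f ⁻¹' closure U.set := by
  rw [set_preimageHom, ho.preimage_closure_eq_closure_preimage hc]

theorem contact_of_contact_preimageHom {U V : RegularOpens Y}
    (h : Contact (preimageHom f ho hc U) (preimageHom f ho hc V)) : Contact U V := by
  obtain ⟨x, hx, hy⟩ := h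
  rw [closure_preimageHom] at hx hy
  exact ⟨f x, hx, hy⟩

/-- By adjointness the left adjoint lies below any regular open set whose preimage contains `V`; the
regularized image of `V` is one. Closedness of `f` then bounds its closure. -/
theorem closure_lambdaAdj_subset (hcl : IsClosedMap f) (V : RegularOpens X) :
    closure (lambdaAdj (preimageHom f ho hc) V).set ⊆ f '' closure V.set := by
  have h : lambdaAdj (preimageHom f ho hc) V ≤ reg (f '' V.set) := by
    rw [gc_lambdaAdj, ← set_subset_set, set_preimageHom, ← image_subset_iff]
    exact subset_reg (ho _ V.isOpen_set)
  exact ((closure_mono (set_subset_set.2 h)).trans (closure_reg_subset _)).trans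
    (closure_minimal (image_mono subset_closure) (hcl _ isClosed_closure))

theorem contact_preimageHom_of_contact_lambdaAdj (hcl : IsClosedMap f) {V : RegularOpens X}
    {U : RegularOpens Y} (h : Contact (lambdaAdj (preimageHom f ho hc) V) U) :
    Contact V (preimageHom f ho hc U) := by
  obtain ⟨y, hy, hyU⟩ := h
  obtain ⟨x, hx, rfl⟩ := closure_lambdaAdj_subset ho hc hcl V hy
  exact ⟨x, hx, by rwa [closure_preimageHom]⟩

end Preimage

omit [TopologicalSpace X] in
theorem eq_of_preimage_eq [T2Space Y] [LocallyCompactSpace Y] {f g : X → Y}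
    (h : ∀ U : RegularOpens Y, f ⁻¹' U.set = g ⁻¹' U.set) : f = g := by
  funext x
  by_contra hne
  obtain ⟨U, hU, hUg, -⟩ := exists_mem_closure_subset (isOpen_compl_singleton (x := g x)) hne
  have hx : x ∈ f ⁻¹' U.set := hU
  rw [h] at hx
  exact hUg (subset_closure hx) rfl

/-! ### Every morphism between algebras of regular open sets is a preimage map -/

section Realization

variable [T2Space X] [LocallyCompactSpace X] [T2Space Y] [LocallyCompactSpace Y]
  {φ : CompleteLatticeHom (RegularOpens Y) (RegularOpens X)}

/-- The `U` with `x` in `φ U` form a proper filter, and `lambdaAdj φ V` is a member with compact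
closure for a bounded `V` around `x`, so the closures have a common point. -/
theorem exists_point (hcontact : ∀ U V, Contact (φ U) (φ V) → Contact U V)
    (hlambda : ∀ V ∈ compacts X, lambdaAdj φ V ∈ compacts Y) (x : X) :
    ∃ y, ∀ U, x ∈ closure (φ U).set → y ∈ closure U.set := by
  obtain ⟨V, hxV, -, hV⟩ := exists_mem_closure_subset isOpen_univ (mem_univ x)
  have hxL : x ∈ (φ (lambdaAdj φ V)).set := (gc_lambdaAdj φ).le_u_l V hxV
  set s : {U : RegularOpens Y // x ∈ (φ U).set} → Set Y := fun U => closure U.1.set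
  obtain ⟨y, hy⟩ : (⋂ U, s U).Nonempty := by
    have : Nonempty {U : RegularOpens Y // x ∈ (φ U).set} := ⟨⟨_, hxL⟩⟩
    have hL : IsCompact (closure (lambdaAdj φ V).set) := hlambda V hV
    have := hL.inter_iInter_nonempty s (fun U => isClosed_closure) ?_
    · exact this.mono inter_subset_right
    · intro t
      have key : ∀ t : Finset {U : RegularOpens Y // x ∈ (φ U).set},
          ∃ W : RegularOpens Y, x ∈ (φ W).set ∧ W ≤ lambdaAdj φ V ∧ ∀ U ∈ t, W ≤ U.1 := by
        intro t
        induction t using Finset.cons_induction with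
        | empty => exact ⟨_, hxL, le_rfl, by simp⟩
        | cons U t hU ih =>
          obtain ⟨W, h1, h2, h3⟩ := ih
          refine ⟨U.1 ⊓ W, ?_, inf_le_right.trans h2, ?_⟩
          · rw [map_inf]
            exact ⟨U.2, h1⟩
          · intro U' hU'
            rcases Finset.mem_cons.1 hU' with rfl | h
            · exact inf_le_left
            · exact inf_le_right.trans (h3 _ h)
      obtain ⟨W, h1, h2, h3⟩ := key t
      have hW : W ≠ ⊥ := by
        rintro rfl
        rw [map_bot] at h1
        exact h1
      obtain ⟨y, hy⟩ := ne_bot_iff.1 hW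
      exact ⟨y, subset_closure (h2 hy), mem_iInter₂.2 fun U hU => subset_closure (h3 U hU hy)⟩
  refine ⟨y, fun U hxU => ?_⟩
  by_contra hyU
  obtain ⟨W, hyW, hWU, -⟩ := exists_mem_closure_subset isClosed_closure.isOpen_compl hyU
  -- Otherwise `Wᶜ` belongs to the filter, and its closure misses `y`. Hence `φ W` and `φ U` touch
  -- at `x`, although `W` and `U` have disjoint closures.
  have hW : x ∈ closure (φ W).set := by
    by_contra hxW
    have h : x ∈ (φ Wᶜ).set := by
      rw [map_compl', set_compl]
      exact hxW
    have hy' : y ∈ closure Wᶜ.set := mem_iInter.1 hy ⟨Wᶜ, h⟩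
    rw [closure_set_compl] at hy'
    exact hy' hyW
  obtain ⟨z, hz, hz'⟩ := hcontact W U ⟨x, hW, hxU⟩
  exact hWU hz hz'

theorem exists_isOpenMap_isProperMap (hcontact : ∀ U V, Contact (φ U) (φ V) → Contact U V)
    (hlambda : ∀ V ∈ compacts X, lambdaAdj φ V ∈ compacts Y)
    (hmap : ∀ U ∈ compacts Y, φ U ∈ compacts X)
    (hopen : ∀ U, ∀ V ∈ compacts X, Contact (lambdaAdj φ V) U → Contact V (φ U)) :
    ∃ f : X → Y, IsOpenMap f ∧ IsProperMap f ∧ ∀ U, f ⁻¹' U.set = (φ U).set := by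
  choose f hf using exists_point hcontact hlambda
  -- One inclusion is the choice of `f`. For the other, the openness condition is applied to a
  -- bounded `V` around `x` whose closure misses that of `φ U`; complements then turn closures into
  -- the sets themselves.
  have hcl : ∀ U, closure (φ U).set = f ⁻¹' closure U.set := by
    intro U
    refine subset_antisymm (fun x hx => hf x U hx) fun x hx => ?_
    by_contra hxU
    obtain ⟨V, hxV, hVU, hV⟩ := exists_mem_closure_subset isClosed_closure.isOpen_compl hxU
    have hfx : f x ∈ closure (lambdaAdj φ V).set :=
      hf x _ (subset_closure ((gc_lambdaAdj φ).le_u_l V hxV))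
    obtain ⟨z, hz, hz'⟩ := hopen U V hV ⟨f x, hfx, hx⟩
    exact hVU hz hz'
  have hpre : ∀ U, f ⁻¹' U.set = (φ U).set := by
    intro U
    have h := hcl Uᶜ
    rw [map_compl', closure_set_compl, closure_set_compl, preimage_compl] at h
    exact (compl_injective h).symm
  have hcont : Continuous f := by
    refine continuous_def.2 fun W hW => isOpen_iff_mem_nhds.2 fun x hx => ?_
    obtain ⟨U, hxU, hUW, -⟩ := exists_mem_closure_subset hW hx
    have hsub : f ⁻¹' U.set ⊆ f ⁻¹' W := preimage_mono (subset_closure.trans hUW)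
    refine Filter.mem_of_superset ?_ hsub
    rw [hpre]
    exact (φ U).isOpen_set.mem_nhds (by rw [← hpre]; exact hxU)
  refine ⟨f, ?_, ?_, hpre⟩
  · intro W hW
    refine isOpen_iff_mem_nhds.2 ?_
    rintro _ ⟨x, hx, rfl⟩
    obtain ⟨V, hxV, hVW, hV⟩ := exists_mem_closure_subset hW hx
    -- The image is compact, so a point outside it has a neighbourhood `U` with closure disjoint
    -- from it, and the openness condition is contradicted. Thus `f '' W` contains the neighbourhood
    -- `lambdaAdj φ V` of `f x`.
    have hL : closure (lambdaAdj φ V).set ⊆ f '' closure V.set := by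
      intro y hy
      by_contra hyV
      obtain ⟨U, hyU, hUV, -⟩ := exists_mem_closure_subset
        ((hV.image hcont).isClosed.isOpen_compl) hyV
      obtain ⟨z, hz, hz'⟩ := hopen U V hV ⟨y, hy, subset_closure hyU⟩
      rw [hcl] at hz'
      exact hUV hz' ⟨z, hz, rfl⟩
    refine Filter.mem_of_superset ((lambdaAdj φ V).isOpen_set.mem_nhds ?_)
      (subset_closure.trans (hL.trans (image_mono hVW)))
    have hxφ : x ∈ (φ (lambdaAdj φ V)).set := (gc_lambdaAdj φ).le_u_l V hxV
    rwa [← hpre] at hxφ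
  · refine isProperMap_iff_isCompact_preimage.2 ⟨hcont, fun K hK => ?_⟩
    obtain ⟨U, hKU, -, hU⟩ := exists_between hK isOpen_univ (subset_univ K)
    have hφU : IsCompact (closure (φ U).set) := hmap U hU
    refine hφU.of_isClosed_subset (hK.isClosed.preimage hcont) ?_
    rw [hcl]
    exact preimage_mono (hKU.trans subset_closure)

end Realization

end RegularOpens

/-! ### Non-tangential inclusion -/

namespace IsContactAlgebra

variable {B : Type u} [BooleanAlgebra B] {ρ : B → B → Prop} (h : IsContactAlgebra ρ)

include h

theorem mono_right {a b c : B} (hbc : b ≤ c) (hab : ρ a b) : ρ a c := by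
  rw [← sup_eq_right.2 hbc, h.sup_right]
  exact Or.inl hab

theorem mono_left {a b c : B} (hab : a ≤ b) (hac : ρ a c) : ρ b c :=
  h.symm _ _ (h.mono_right hab (h.symm _ _ hac))

theorem nonTangential_mono {a b c d : B} (hab : a ≤ b) (hbc : NonTangential ρ b c) (hcd : c ≤ d) :
    NonTangential ρ a d := fun had =>
  hbc (h.mono_left hab (h.mono_right (compl_le_compl hcd) had))

theorem nonTangential_compl {a b : B} (hab : NonTangential ρ a b) : NonTangential ρ bᶜ aᶜ := by
  intro hba
  rw [compl_compl] at hba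
  exact hab (h.symm _ _ hba)

theorem le_of_nonTangential {a b : B} (hab : NonTangential ρ a b) : a ≤ b := by
  rw [← disjoint_compl_right_iff, disjoint_iff]
  by_contra hne
  exact hab (h.mono_left inf_le_left (h.mono_right inf_le_right (h.refl_of_ne_bot _ hne)))

theorem nonTangential_top (a : B) : NonTangential ρ a ⊤ := fun ha =>
  (h.ne_bot _ _ ha).2 compl_top

theorem nonTangential_inf {a b c : B} (hab : NonTangential ρ a b) (hac : NonTangential ρ a c) :
    NonTangential ρ a (b ⊓ c) := by
  rw [NonTangential, compl_inf, h.sup_right, not_or]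
  exact ⟨hab, hac⟩

theorem nonTangential_inf_inf {a b c d : B} (hab : NonTangential ρ a b)
    (hcd : NonTangential ρ c d) : NonTangential ρ (a ⊓ c) (b ⊓ d) :=
  h.nonTangential_inf (h.nonTangential_mono inf_le_left hab le_rfl)
    (h.nonTangential_mono inf_le_right hcd le_rfl)

/-- Elements in contact with `b` extend to a prime filter all of whose elements touch `b`. -/
theorem exists_prime_contact {a b : B} (hab : ρ a b) :
    ∃ u : Set B, a ∈ u ∧ (∀ x ∈ u, ∀ y ∈ u, x ⊓ y ∈ u) ∧ (∀ x ∈ u, ρ x b) ∧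
      ∀ x, x ∈ u ∨ xᶜ ∈ u := by
  -- The elements not touching `b` form an ideal without any member above `a`; `u` will be the
  -- complement of a prime ideal containing it.
  let J : Order.Ideal B :=
    { carrier := {x | ¬ ρ x b}
      lower' := fun x y hyx hx hy => hx (h.mono_left hyx hy)
      nonempty' := ⟨⊥, fun hb => (h.ne_bot _ _ hb).1 rfl⟩
      directed' := fun x hx y hy => ⟨x ⊔ y, fun hxy => by
        rcases (h.sup_right _ _ _).1 (h.symm _ _ hxy) with h' | h'
        · exact hx (h.symm _ _ h')
        · exact hy (h.symm _ _ h'), le_sup_left, le_sup_right⟩ }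
  obtain ⟨P, hP, hJP, hdisj⟩ := DistribLattice.prime_ideal_of_disjoint_filter_ideal
    (F := Order.PFilter.principal a) (I := J)
    (Set.disjoint_left.2 fun x hx hxJ => hxJ (h.mono_left (Order.PFilter.mem_principal.1 hx) hab))
  refine ⟨{x | x ∉ P}, ?_, ?_, ?_, ?_⟩
  · exact Set.disjoint_left.1 hdisj (Order.PFilter.mem_principal.2 le_rfl)
  · intro x hx y hy hxy
    exact (hP.mem_or_mem hxy).elim hx hy
  · intro x hx
    by_contra hxb
    exact hx (hJP hxb)
  · intro x
    by_contra! hx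
    have h1 : x ∈ P := not_not.1 hx.1
    have h2 : xᶜ ∈ P := not_not.1 hx.2
    have h3 := Order.Ideal.sup_mem h1 h2
    rw [sup_compl_eq_top] at h3
    exact hP.toIsProper.top_notMem h3

end IsContactAlgebra

/-! ### The space of ends of a local contact algebra -/

/-- An end of a local contact algebra: a proper round filter containing a bounded element and
deciding every non-tangential inclusion. -/
structure ContactEnd {B : Type u} [BooleanAlgebra B] (ρ : B → B → Prop) (I : Order.Ideal B) :
    Type u where
  carrier : Set B
  mem_of_le : ∀ {a b}, a ≤ b → a ∈ carrier → b ∈ carrier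
  inf_mem : ∀ {a b}, a ∈ carrier → b ∈ carrier → a ⊓ b ∈ carrier
  bot_notMem : ⊥ ∉ carrier
  round : ∀ b ∈ carrier, ∃ a ∈ carrier, NonTangential ρ a b
  prime : ∀ a b, NonTangential ρ a b → aᶜ ∈ carrier ∨ b ∈ carrier
  exists_bounded : ∃ e ∈ I, e ∈ carrier

namespace ContactEnd

section BooleanAlgebra

variable {B : Type u} [BooleanAlgebra B] {ρ : B → B → Prop} {I : Order.Ideal B}

theorem carrier_injective : Function.Injective (carrier : ContactEnd ρ I → Set B) := by
  rintro ⟨⟩ ⟨⟩ rfl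
  rfl

/-- The set of ends containing `a`. -/
def basic (ρ : B → B → Prop) (I : Order.Ideal B) (a : B) : Set (ContactEnd ρ I) :=
  {p | a ∈ p.carrier}

theorem mem_basic {a : B} {p : ContactEnd ρ I} : p ∈ basic ρ I a ↔ a ∈ p.carrier := Iff.rfl

theorem basic_mono {a b : B} (hab : a ≤ b) : basic ρ I a ⊆ basic ρ I b := fun p hp =>
  p.mem_of_le hab hp

theorem basic_inf (a b : B) : basic ρ I (a ⊓ b) = basic ρ I a ∩ basic ρ I b :=
  subset_antisymm (subset_inter (basic_mono inf_le_left) (basic_mono inf_le_right))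
    fun p hp => p.inf_mem hp.1 hp.2

theorem basic_bot : basic ρ I ⊥ = ∅ := eq_empty_of_forall_notMem fun p => p.bot_notMem

theorem compl_notMem {a : B} {p : ContactEnd ρ I} (ha : a ∈ p.carrier) : aᶜ ∉ p.carrier :=
  fun hac => p.bot_notMem (by simpa using p.inf_mem ha hac)

instance : TopologicalSpace (ContactEnd ρ I) :=
  TopologicalSpace.generateFrom (range (basic ρ I))

theorem isOpen_basic (a : B) : IsOpen (basic ρ I a) :=
  TopologicalSpace.isOpen_generateFrom_of_mem ⟨a, rfl⟩

theorem isTopologicalBasis_basic : IsTopologicalBasis (range (basic ρ I)) where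
  exists_subset_inter := by
    rintro _ ⟨a, rfl⟩ _ ⟨b, rfl⟩ p hp
    exact ⟨_, ⟨a ⊓ b, rfl⟩, p.inf_mem hp.1 hp.2, (basic_inf a b).subset⟩
  sUnion_eq := sUnion_eq_univ_iff.2 fun p => by
    obtain ⟨e, -, he⟩ := p.exists_bounded
    exact ⟨_, ⟨e, rfl⟩, he⟩
  eq_generateFrom := rfl

variable (h : IsLocalContactAlgebra ρ I)

include h

/-- Primeness is required of `u` only across non-tangential inclusions, so that this covers both
prime filters and the traces of ultrafilters of ends. -/
theorem exists_end {u : Set B} (hinf : ∀ x ∈ u, ∀ y ∈ u, x ⊓ y ∈ u) (hbot : ⊥ ∉ u)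
    (hprime : ∀ x y, NonTangential ρ x y → xᶜ ∈ u ∨ y ∈ u) (hbdd : ∃ e ∈ I, e ∈ u) :
    ∃ p : ContactEnd ρ I, p.carrier = {b | ∃ c ∈ u, NonTangential ρ c b} := by
  obtain ⟨e₀, he₀I, he₀⟩ := hbdd
  have hca := h.toIsContactAlgebra
  obtain ⟨e, heI, he, -⟩ := h.interpolate e₀ he₀I ⊤ (hca.nonTangential_top e₀)
  have hround : ∀ b, (∃ c ∈ u, NonTangential ρ c b) →
      ∃ a ∈ I, (∃ c ∈ u, NonTangential ρ c a) ∧ NonTangential ρ a b := by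
    rintro b ⟨c, hc, hcb⟩
    obtain ⟨a, haI, hca', hab⟩ := h.interpolate (c ⊓ e₀) (I.lower inf_le_right he₀I) b
      (hca.nonTangential_mono inf_le_left hcb le_rfl)
    exact ⟨a, haI, ⟨_, hinf _ hc _ he₀, hca'⟩, hab⟩
  have hmono : ∀ {a b : B}, a ≤ b → (∃ c ∈ u, NonTangential ρ c a) →
      ∃ c ∈ u, NonTangential ρ c b := fun hab ⟨c, hc, hca'⟩ =>
    ⟨c, hc, hca.nonTangential_mono le_rfl hca' hab⟩
  have hinf' : ∀ {a b : B}, (∃ c ∈ u, NonTangential ρ c a) → (∃ c ∈ u, NonTangential ρ c b) →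
      ∃ c ∈ u, NonTangential ρ c (a ⊓ b) := fun ⟨c, hc, hca'⟩ ⟨d, hd, hdb⟩ =>
    ⟨c ⊓ d, hinf _ hc _ hd, hca.nonTangential_inf_inf hca' hdb⟩
  refine ⟨⟨{b | ∃ c ∈ u, NonTangential ρ c b}, hmono, hinf', ?_, ?_, ?_, ⟨e, heI, e₀, he₀, he⟩⟩,
    rfl⟩
  · rintro ⟨c, hc, hcb⟩
    exact hbot (le_bot_iff.1 (hca.le_of_nonTangential hcb) ▸ hc)
  · intro b hb
    obtain ⟨a, -, ha, hab⟩ := hround b hb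
    exact ⟨a, ha, hab⟩
  · intro a b hab
    -- Interpolation needs a bounded element, so `a` is cut down by `e`. This loses nothing because
    -- `e` is in the end and `(a ⊓ e)ᶜ ⊓ e ≤ aᶜ`.
    obtain ⟨d, hdI, had, hdb⟩ := h.interpolate (a ⊓ e) (I.lower inf_le_right heI) b
      (hca.nonTangential_mono inf_le_left hab le_rfl)
    obtain ⟨d', -, hdd', hdb'⟩ := h.interpolate d hdI b hdb
    rcases hprime d d' hdd' with hd | hd
    · refine Or.inl (hmono (a := (a ⊓ e)ᶜ ⊓ e) ?_
        (hinf' ⟨_, hd, hca.nonTangential_compl had⟩ ⟨e₀, he₀, he⟩))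
      rw [compl_inf, inf_sup_right, compl_inf_self, sup_bot_eq]
      exact inf_le_left
    · exact Or.inr ⟨d', hd, hdb'⟩

theorem exists_end_of_contact {a b : B} (ha : a ∈ I) (hab : ρ a b) :
    ∃ p : ContactEnd ρ I, aᶜ ∉ p.carrier ∧ bᶜ ∉ p.carrier ∧
      ∀ c, NonTangential ρ a c → c ∈ p.carrier := by
  have hca := h.toIsContactAlgebra
  obtain ⟨u, hau, hinf, hub, hprime⟩ := hca.exists_prime_contact hab
  have hbot : ⊥ ∉ u := fun hbot => (hca.ne_bot _ _ (hub _ hbot)).1 rfl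
  have hup : ∀ x y, x ≤ y → x ∈ u → y ∈ u := by
    intro x y hxy hx
    refine (hprime y).resolve_right fun hy => hbot ?_
    have hle : x ⊓ yᶜ = ⊥ := disjoint_iff.1 (disjoint_compl_right_iff.2 hxy)
    exact hle ▸ hinf _ hx _ hy
  obtain ⟨p, hp⟩ := exists_end h hinf hbot (fun x y hxy => (hprime x).symm.imp_right
    (hup x y (hca.le_of_nonTangential hxy))) ⟨a, ha, hau⟩
  refine ⟨p, ?_, ?_, fun c hac => ?_⟩
  · rw [hp]
    rintro ⟨c, hc, hcx⟩
    refine hbot ?_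
    have hle : c ⊓ a = ⊥ := disjoint_iff.1
      (le_compl_iff_disjoint_right.1 (hca.le_of_nonTangential hcx))
    exact hle ▸ hinf _ hc _ hau
  · rw [hp]
    rintro ⟨c, hc, hcx⟩
    rw [NonTangential, compl_compl] at hcx
    exact hcx (hub c hc)
  · rw [hp]
    exact ⟨a, hau, hac⟩

theorem basic_nonempty {a : B} (ha : a ≠ ⊥) : (basic ρ I a).Nonempty := by
  obtain ⟨b, hbI, hb, hba⟩ := h.bounded_below a ha
  obtain ⟨p, -, -, hp⟩ := exists_end_of_contact h hbI (h.refl_of_ne_bot b hb)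
  exact ⟨p, hp a hba⟩

/-- If every end containing `aᶜ` is excluded, each basic neighbourhood `b` meets `a` in a nonzero
element, and nonzero elements lie in some end. -/
theorem closure_basic (a : B) : closure (basic ρ I a) = (basic ρ I aᶜ)ᶜ := by
  ext p
  rw [isTopologicalBasis_basic.mem_closure_iff]
  constructor
  · intro hp hpa
    obtain ⟨q, hq, hqa⟩ := hp _ ⟨aᶜ, rfl⟩ hpa
    exact compl_notMem hqa hq
  · rintro hp _ ⟨b, rfl⟩ hb
    rw [← basic_inf]
    refine basic_nonempty h fun hba => hp ?_
    exact p.mem_of_le (le_compl_iff_disjoint_right.2 (disjoint_iff.2 hba)) hb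

theorem basic_subset_basic {a b : B} : basic ρ I a ⊆ basic ρ I b ↔ a ≤ b := by
  refine ⟨fun hab => ?_, basic_mono⟩
  rw [← disjoint_compl_right_iff, disjoint_iff]
  by_contra hne
  obtain ⟨p, hp⟩ := basic_nonempty h hne
  rw [basic_inf] at hp
  exact compl_notMem (hab hp.1) hp.2

theorem closure_basic_subset {a b : B} (hab : NonTangential ρ a b) :
    closure (basic ρ I a) ⊆ basic ρ I b := by
  rw [closure_basic h]
  exact fun p hp => (p.prime a b hab).resolve_left hp

theorem interior_closure_basic (a : B) : interior (closure (basic ρ I a)) = basic ρ I a := by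
  rw [closure_basic h, interior_compl, closure_basic h, compl_compl, compl_compl]

theorem contact_iff (a b : B) :
    (closure (basic ρ I a) ∩ closure (basic ρ I b)).Nonempty ↔ ρ a b := by
  rw [closure_basic h, closure_basic h]
  have hca := h.toIsContactAlgebra
  constructor
  · rintro ⟨p, hpa, hpb⟩
    by_contra hab
    rw [← compl_compl b] at hab
    exact (p.prime a bᶜ hab).elim hpa hpb
  · intro hab
    obtain ⟨c, hcI, hc⟩ := h.bounded_witness b a (hca.symm _ _ hab)
    obtain ⟨p, hpa, hpb, -⟩ := exists_end_of_contact h (I.lower inf_le_left hcI) (hca.symm _ _ hc)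
    exact ⟨p, fun hp => hpa (p.mem_of_le (compl_le_compl inf_le_right) hp), hpb⟩

omit h in
theorem t2Space : T2Space (ContactEnd ρ I) := by
  have key : ∀ p q : ContactEnd ρ I, ∀ a ∈ p.carrier, a ∉ q.carrier →
      ∃ b, b ∈ p.carrier ∧ bᶜ ∈ q.carrier := by
    intro p q a hp hq
    obtain ⟨b, hb, hba⟩ := p.round a hp
    exact ⟨b, hb, (q.prime b a hba).resolve_right hq⟩
  refine ⟨fun p q hpq => ?_⟩
  obtain ⟨b, hb, hb'⟩ : ∃ b, b ∈ p.carrier ∧ bᶜ ∈ q.carrier := by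
    by_contra! hno
    apply hpq
    apply carrier_injective
    apply subset_antisymm
    · intro a ha
      by_contra haq
      obtain ⟨b, h1, h2⟩ := key p q a ha haq
      exact hno b h1 h2
    · intro a ha
      by_contra hap
      obtain ⟨b, h1, h2⟩ := key q p a ha hap
      exact hno bᶜ h2 (by rwa [compl_compl])
  refine ⟨_, _, isOpen_basic b, isOpen_basic bᶜ, hb, hb', Set.disjoint_left.2 fun r hr hr' => ?_⟩
  exact compl_notMem hr hr'

theorem isCompact_closure_basic {a : B} (ha : a ∈ I) : IsCompact (closure (basic ρ I a)) := by
  have hca := h.toIsContactAlgebra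
  obtain ⟨e, heI, hae, -⟩ := h.interpolate a ha ⊤ (hca.nonTangential_top a)
  refine isCompact_iff_ultrafilter_le_nhds.2 fun F hF => ?_
  have haF : closure (basic ρ I a) ∈ F := Filter.le_principal_iff.1 hF
  -- The limit of the ultrafilter is the end generated by its trace on basic sets. If `x ≪ y`, the
  -- sets `basic xᶜ` and `basic y` cover the space, so one of them is in `F`.
  obtain ⟨p, hp⟩ := exists_end h (u := {b | basic ρ I b ∈ F})
    (fun x hx y hy => by
      rw [mem_ofPred_eq, basic_inf]
      exact Filter.inter_mem hx hy)
    (by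
      rw [mem_ofPred_eq, basic_bot]
      exact Ultrafilter.empty_notMem)
    (fun x y hxy => by
      refine or_iff_not_imp_right.2 fun hy => ?_
      refine Filter.mem_of_superset (Ultrafilter.compl_mem_iff_notMem.2 hy) ?_
      rw [compl_subset_comm, ← closure_basic h]
      exact closure_basic_subset h hxy)
    ⟨e, heI, Filter.mem_of_superset haF (closure_basic_subset h hae)⟩
  have hle : (F : Filter (ContactEnd ρ I)) ≤ 𝓝 p := by
    refine (isTopologicalBasis_basic.nhds_hasBasis).ge_iff.2 ?_
    rintro _ ⟨⟨b, rfl⟩, hb⟩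
    rw [mem_basic, hp] at hb
    obtain ⟨c, hc, hcb⟩ := hb
    exact Filter.mem_of_superset hc (basic_mono (hca.le_of_nonTangential hcb))
  exact ⟨p, isClosed_closure.mem_of_tendsto hle haF, hle⟩

/-- Bounded basic sets form a directed open cover, so a compact closure lies in a single one. -/
theorem isCompact_closure_basic_iff {a : B} : IsCompact (closure (basic ρ I a)) ↔ a ∈ I := by
  refine ⟨fun ha => ?_, isCompact_closure_basic h⟩
  have : Nonempty I := I.nonempty.to_subtype
  obtain ⟨t, ht⟩ := ha.elim_directed_cover (fun e : I => basic ρ I e.1)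
    (fun e => isOpen_basic e.1)
    (fun p _ => by
      obtain ⟨e, heI, he⟩ := p.exists_bounded
      exact mem_iUnion.2 ⟨⟨e, heI⟩, he⟩)
    (fun x y => ⟨⟨x.1 ⊔ y.1, Order.Ideal.sup_mem x.2 y.2⟩, basic_mono le_sup_left,
      basic_mono le_sup_right⟩)
  exact I.lower ((basic_subset_basic h).1 (subset_closure.trans ht)) t.2

theorem locallyCompactSpace : LocallyCompactSpace (ContactEnd ρ I) := by
  have : T2Space (ContactEnd ρ I) := t2Space
  have : WeaklyLocallyCompactSpace (ContactEnd ρ I) := ⟨fun p => by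
    obtain ⟨e, heI, he⟩ := p.exists_bounded
    exact ⟨_, isCompact_closure_basic h heI,
      Filter.mem_of_superset ((isOpen_basic e).mem_nhds he) subset_closure⟩⟩
  infer_instance

omit h in
theorem compactSpace (h : IsLocalContactAlgebra ρ ⊤) : CompactSpace (ContactEnd ρ ⊤) := by
  have huniv : closure (basic ρ ⊤ ⊤) = univ := by
    rw [closure_basic h, compl_top, basic_bot, compl_empty]
  exact ⟨huniv ▸ isCompact_closure_basic h trivial⟩

end BooleanAlgebra

section CompleteBooleanAlgebra

variable {B : Type u} [CompleteBooleanAlgebra B] {ρ : B → B → Prop} {I : Order.Ideal B}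
  (h : IsLocalContactAlgebra ρ I)

include h

theorem set_reg_basic (a : B) : (RegularOpens.reg (basic ρ I a)).set = basic ρ I a :=
  interior_closure_basic h a

theorem exists_reg_basic_eq (W : RegularOpens (ContactEnd ρ I)) :
    ∃ a, RegularOpens.reg (basic ρ I a) = W := by
  refine ⟨sSup {b | basic ρ I b ⊆ W.set}, RegularOpens.set_injective ?_⟩
  apply subset_antisymm
  · refine (interior_mono (closure_minimal (fun p hp => ?_) isClosed_closure)).trans
      W.interior_closure_set.subset
    rw [isTopologicalBasis_basic.mem_closure_iff]
    rintro _ ⟨c, rfl⟩ hc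
    -- Meets distribute over arbitrary joins, so `c` already meets one of the joined elements.
    have hne : c ⊓ sSup {b | basic ρ I b ⊆ W.set} ≠ ⊥ := fun hbot =>
      p.bot_notMem (hbot ▸ p.inf_mem hc hp)
    obtain ⟨b, hb, hcb⟩ : ∃ b, basic ρ I b ⊆ W.set ∧ c ⊓ b ≠ ⊥ := by
      by_contra! hno
      apply hne
      rw [inf_sSup_eq]
      exact iSup₂_eq_bot.2 hno
    obtain ⟨q, hq⟩ := basic_nonempty h hcb
    rw [basic_inf] at hq
    exact ⟨q, hq.1, hb hq.2⟩
  · rw [set_reg_basic h]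
    intro p hp
    obtain ⟨_, ⟨b, rfl⟩, hpb, hb⟩ := isTopologicalBasis_basic.exists_subset_of_mem_open hp
      W.isOpen_set
    exact basic_mono (le_sSup (mem_ofPred_eq ▸ hb)) hpb

/-- A complete local contact algebra is isomorphic to the algebra of regular open sets of its
space of ends. -/
noncomputable def regularOpensIso : B ≃o RegularOpens (ContactEnd ρ I) :=
  RelIso.ofSurjective
    (OrderEmbedding.ofMapLEIff (fun a => RegularOpens.reg (basic ρ I a)) fun a b => by
      rw [← RegularOpens.set_subset_set, set_reg_basic h, set_reg_basic h, basic_subset_basic h])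
    (exists_reg_basic_eq h)

theorem set_regularOpensIso (a : B) : (regularOpensIso h a).set = basic ρ I a :=
  set_reg_basic h a

theorem contact_regularOpensIso (a b : B) :
    RegularOpens.Contact (regularOpensIso h a) (regularOpensIso h b) ↔ ρ a b := by
  rw [RegularOpens.Contact, set_regularOpensIso, set_regularOpensIso, contact_iff h]

theorem regularOpensIso_mem_compacts (a : B) :
    regularOpensIso h a ∈ RegularOpens.compacts _ ↔ a ∈ I := by
  rw [RegularOpens.mem_compacts, set_regularOpensIso, isCompact_closure_basic_iff h]

theorem preconnectedSpace (hcon : IsConnectedContact ρ) : PreconnectedSpace (ContactEnd ρ I) := by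
  refine RegularOpens.isConnectedContact_iff.1 fun U hbot htop => ?_
  obtain ⟨a, rfl⟩ := (regularOpensIso h).surjective U
  rw [← map_compl', contact_regularOpensIso]
  exact hcon a (fun ha => hbot (by rw [ha, map_bot])) (fun ha => htop (by rw [ha, map_top]))

end CompleteBooleanAlgebra

end ContactEnd

/-! ### Normal contact algebras as local contact algebras -/

/-- With every element bounded, interpolation is separation and `bounded_below` is extensionality,
both up to complements, while `bounded_witness` is trivial. -/
theorem isLocalContactAlgebra_top_iff {B : Type u} [BooleanAlgebra B] {C : B → B → Prop} :
    IsLocalContactAlgebra C ⊤ ↔ IsNormalContactAlgebra C := by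
  constructor
  · intro h
    refine { h.toIsContactAlgebra with separation := ?_, extensional := ?_ }
    · intro a b hab
      rw [← compl_compl b] at hab
      obtain ⟨c, -, hac, hcb⟩ := h.interpolate a trivial bᶜ hab
      refine ⟨cᶜ, hac, fun hbc => hcb (h.symm _ _ ?_)⟩
      rwa [compl_compl] at hbc ⊢
    · intro a ha
      obtain ⟨b, -, hb, hba⟩ := h.bounded_below aᶜ (by rwa [Ne, compl_eq_bot])
      rw [NonTangential, compl_compl] at hba
      exact ⟨b, hb, hba⟩
  · intro h
    refine
      { h.toIsContactAlgebra with interpolate := ?_, bounded_witness := ?_, bounded_below := ?_ }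
    · intro a _ c hac
      obtain ⟨d, had, hcd⟩ := h.separation a cᶜ hac
      refine ⟨dᶜ, trivial, ?_, fun hdc => hcd (h.symm _ _ hdc)⟩
      rwa [NonTangential, compl_compl]
    · intro a b hab
      exact ⟨⊤, trivial, by rwa [top_inf_eq]⟩
    · intro a ha
      obtain ⟨b, hb, hba⟩ := h.extensional aᶜ (by rwa [Ne, compl_eq_top])
      refine ⟨b, trivial, hb, hba⟩

theorem lambdaAdj_toCompleteLatticeHom {A B : Type u} [CompleteBooleanAlgebra A]
    [CompleteBooleanAlgebra B] (e : A ≃o B) (b : B) :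
    lambdaAdj (CompleteLatticeHom.OrderIso.toCompleteLatticeHom e) b = e.symm b :=
  (gc_lambdaAdj (CompleteLatticeHom.OrderIso.toCompleteLatticeHom e)).l_unique e.symm.to_galoisConnection fun _ => rfl

/-- A fully faithful contravariant functor restricts to a dual equivalence of full subcategories
if it is essentially surjective between them. -/
theorem nonempty_equivalence_fullSubcategory {C D : Type*} [Category* C] [Category* D]
    {P : ObjectProperty C} {Q : ObjectProperty D} (F : Cᵒᵖ ⥤ D) [F.Full] [F.Faithful]
    (hF : ∀ X, P X → Q (F.obj (op X)))
    (hsurj : ∀ A, Q A → ∃ X, P X ∧ Nonempty (F.obj (op X) ≅ A)) :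
    Nonempty (P.FullSubcategoryᵒᵖ ≌ Q.FullSubcategory) := by
  let G : P.FullSubcategoryᵒᵖ ⥤ Q.FullSubcategory :=
    Q.lift (P.ι.op ⋙ F) fun X => hF _ X.unop.property
  have : G.EssSurj := ⟨fun A => by
    obtain ⟨X, hX, ⟨e⟩⟩ := hsurj A.obj A.property
    exact ⟨op ⟨X, hX⟩, ⟨Q.isoMk e⟩⟩⟩
  have : G.IsEquivalence := { }
  exact ⟨G.asEquivalence⟩

/-! ### The duality for locally compact Hausdorff spaces -/

namespace DOpPerLC

theorem hom_ext {A B : DOpPerLC.{u}} {f g : A ⟶ B} (h : Hom.toHom f = Hom.toHom g) : f = g := by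
  obtain ⟨_, _, _, _, _⟩ : Hom A B := f
  obtain ⟨_, _, _, _, _⟩ : Hom A B := g
  cases h
  rfl

/-- The morphism given by an order isomorphism preserving contact and boundedness. -/
def homOfOrderIso {A B : DOpPerLC.{u}} (e : A ≃o B) (hrel : ∀ a b, B.rel (e a) (e b) ↔ A.rel a b)
    (hbdd : ∀ a, e a ∈ B.bounded ↔ a ∈ A.bounded) : A ⟶ B :=
  Hom.mk (A := A) (B := B) (CompleteLatticeHom.OrderIso.toCompleteLatticeHom e) (fun a b => (hrel a b).1)
    (fun b hb => by
      rw [lambdaAdj_toCompleteLatticeHom, ← hbdd, e.apply_symm_apply]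
      exact hb)
    (fun a => (hbdd a).2)
    (fun a b _ h => by
      rw [lambdaAdj_toCompleteLatticeHom, ← hrel, e.apply_symm_apply] at h
      exact h)

/-- The isomorphism given by an order isomorphism preserving contact and boundedness. -/
def isoOfOrderIso {A B : DOpPerLC.{u}} (e : A ≃o B) (hrel : ∀ a b, B.rel (e a) (e b) ↔ A.rel a b)
    (hbdd : ∀ a, e a ∈ B.bounded ↔ a ∈ A.bounded) : A ≅ B where
  hom := homOfOrderIso e hrel hbdd
  inv := homOfOrderIso e.symm (fun a b => by rw [← hrel, e.apply_symm_apply, e.apply_symm_apply])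
    (fun a => by rw [← hbdd, e.apply_symm_apply])
  hom_inv_id := hom_ext (DFunLike.ext _ _ e.symm_apply_apply)
  inv_hom_id := hom_ext (DFunLike.ext (F := CompleteLatticeHom B B) _ _ e.apply_symm_apply)

end DOpPerLC

namespace OpPerLC

theorem hom_ext {X Y : OpPerLC.{u}} {f g : X ⟶ Y} (h : Hom.toFun f = Hom.toFun g) : f = g := by
  obtain ⟨_, _, _⟩ : Hom X Y := f
  obtain ⟨_, _, _⟩ : Hom X Y := g
  cases h
  rfl

/-- The complete local contact algebra of regular open sets. -/
def algebra (X : OpPerLC.{u}) : DOpPerLC.{u} where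
  carrier := RegularOpens X
  rel := RegularOpens.Contact
  bounded := RegularOpens.compacts X
  isLocalContactAlgebra := RegularOpens.isLocalContactAlgebra

/-- Preimage along an open perfect map. -/
def algebraMap {X Y : OpPerLC.{u}} (f : X ⟶ Y) : Y.algebra ⟶ X.algebra :=
  DOpPerLC.Hom.mk (A := Y.algebra) (B := X.algebra)
    (RegularOpens.preimageHom (Hom.toFun f) (Hom.isOpenMap f) (Hom.isPerfectMap f).continuous)
    (fun _ _ h => RegularOpens.contact_of_contact_preimageHom _ _ h)
    (fun V hV => (IsCompact.image hV (Hom.isPerfectMap f).continuous).of_isClosed_subset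
      isClosed_closure
      (RegularOpens.closure_lambdaAdj_subset _ _ (Hom.isPerfectMap f).isClosedMap V))
    (fun U hU => (congrArg IsCompact (RegularOpens.closure_preimageHom (Hom.isOpenMap f)
      (Hom.isPerfectMap f).continuous U)).mpr
        ((isPerfectMap_iff_isProperMap.1 (Hom.isPerfectMap f)).isCompact_preimage hU))
    (fun _ _ _ h => RegularOpens.contact_preimageHom_of_contact_lambdaAdj _ _
      (Hom.isPerfectMap f).isClosedMap h)

theorem set_algebraMap {X Y : OpPerLC.{u}} (f : X ⟶ Y) (U : RegularOpens Y) :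
    RegularOpens.set (DOpPerLC.Hom.toHom (algebraMap f) U) = Hom.toFun f ⁻¹' U.set :=
  RegularOpens.set_preimageHom (Hom.isOpenMap f) (Hom.isPerfectMap f).continuous U

/-- The contravariant functor sending a space to its algebra of regular open sets. -/
def algebraFunctor : OpPerLC.{u}ᵒᵖ ⥤ DOpPerLC.{u} where
  obj X := X.unop.algebra
  map f := algebraMap f.unop
  map_id X := DOpPerLC.hom_ext (DFunLike.ext _ _ fun U =>
    RegularOpens.set_injective (set_algebraMap (𝟙 X.unop) U))
  map_comp f g := DOpPerLC.hom_ext (DFunLike.ext _ _ fun U =>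
    RegularOpens.set_injective ((set_algebraMap (g.unop ≫ f.unop) U).trans
      ((set_algebraMap g.unop (DOpPerLC.Hom.toHom (algebraMap f.unop) U)).trans
        (congrArg _ (set_algebraMap f.unop U))).symm))

instance : algebraFunctor.{u}.Faithful where
  map_injective {X Y} f g hfg := Quiver.Hom.unop_inj (hom_ext (RegularOpens.eq_of_preimage_eq
    fun U => by
      rw [← set_algebraMap f.unop U, ← set_algebraMap g.unop U]
      exact congrArg (fun k => RegularOpens.set (DOpPerLC.Hom.toHom k U)) hfg))

instance : algebraFunctor.{u}.Full where
  map_surjective {X Y} φ := by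
    obtain ⟨f, ho, hp, hf⟩ := RegularOpens.exists_isOpenMap_isProperMap
      (DOpPerLC.Hom.rel_of_rel_map φ) (DOpPerLC.Hom.bounded_lambdaAdj φ)
      (DOpPerLC.Hom.bounded_map φ) (DOpPerLC.Hom.openness φ)
    let F : Y.unop ⟶ X.unop := Hom.mk (X := Y.unop) (Y := X.unop) f ho
      (isPerfectMap_iff_isProperMap.2 hp)
    exact ⟨F.op, DOpPerLC.hom_ext (DFunLike.ext _ _ fun U =>
      RegularOpens.set_injective ((set_algebraMap F U).trans (hf U)))⟩

theorem exists_iso_algebra (A : DOpPerLC.{u}) : ∃ X : OpPerLC.{u}, Nonempty (X.algebra ≅ A) ∧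
    (IsConnectedContact A.rel → PreconnectedSpace X) := by
  have h := A.isLocalContactAlgebra
  have := ContactEnd.t2Space (ρ := A.rel) (I := A.bounded)
  have := ContactEnd.locallyCompactSpace h
  refine ⟨⟨ContactEnd A.rel A.bounded⟩, ⟨(DOpPerLC.isoOfOrderIso
    (B := algebra ⟨ContactEnd A.rel A.bounded⟩) (ContactEnd.regularOpensIso h)
    (ContactEnd.contact_regularOpensIso h) (ContactEnd.regularOpensIso_mem_compacts h)).symm⟩, ?_⟩
  exact ContactEnd.preconnectedSpace h

end OpPerLC

/-! ### The duality for compact Hausdorff spaces -/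

namespace DOpC

theorem hom_ext {A B : DOpC.{u}} {f g : A ⟶ B} (h : Hom.toHom f = Hom.toHom g) : f = g := by
  obtain ⟨_, _, _⟩ : Hom A B := f
  obtain ⟨_, _, _⟩ : Hom A B := g
  cases h
  rfl

/-- The morphism given by an order isomorphism preserving contact. -/
def homOfOrderIso {A B : DOpC.{u}} (e : A ≃o B) (hrel : ∀ a b, B.rel (e a) (e b) ↔ A.rel a b) :
    A ⟶ B :=
  Hom.mk (A := A) (B := B) (CompleteLatticeHom.OrderIso.toCompleteLatticeHom e) (fun a b => (hrel a b).1)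
    (fun a b h => by
      rw [lambdaAdj_toCompleteLatticeHom, ← hrel, e.apply_symm_apply] at h
      exact h)

/-- The isomorphism given by an order isomorphism preserving contact. -/
def isoOfOrderIso {A B : DOpC.{u}} (e : A ≃o B) (hrel : ∀ a b, B.rel (e a) (e b) ↔ A.rel a b) :
    A ≅ B where
  hom := homOfOrderIso e hrel
  inv := homOfOrderIso e.symm (fun a b => by rw [← hrel, e.apply_symm_apply, e.apply_symm_apply])
  hom_inv_id := hom_ext (DFunLike.ext _ _ e.symm_apply_apply)
  inv_hom_id := hom_ext (DFunLike.ext (F := CompleteLatticeHom B B) _ _ e.apply_symm_apply)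

end DOpC

namespace OpC

theorem hom_ext {X Y : OpC.{u}} {f g : X ⟶ Y} (h : Hom.toFun f = Hom.toFun g) : f = g := by
  obtain ⟨_, _, _⟩ : Hom X Y := f
  obtain ⟨_, _, _⟩ : Hom X Y := g
  cases h
  rfl

/-- The complete normal contact algebra of regular open sets. -/
def algebra (X : OpC.{u}) : DOpC.{u} where
  carrier := RegularOpens X
  rel := RegularOpens.Contact
  isNormalContactAlgebra := isLocalContactAlgebra_top_iff.1
    (RegularOpens.compacts_eq_top (X := X) ▸ RegularOpens.isLocalContactAlgebra)

/-- Preimage along an open map. -/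
def algebraMap {X Y : OpC.{u}} (f : X ⟶ Y) : Y.algebra ⟶ X.algebra :=
  DOpC.Hom.mk (A := Y.algebra) (B := X.algebra)
    (RegularOpens.preimageHom (Hom.toFun f) (Hom.isOpenMap f) (Hom.continuous f))
    (fun _ _ h => RegularOpens.contact_of_contact_preimageHom _ _ h)
    (fun _ _ h => RegularOpens.isContactAlgebra.symm _ _
      (RegularOpens.contact_preimageHom_of_contact_lambdaAdj _ _ (Hom.continuous f).isClosedMap
        (RegularOpens.isContactAlgebra.symm _ _ h)))

theorem set_algebraMap {X Y : OpC.{u}} (f : X ⟶ Y) (U : RegularOpens Y) :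
    RegularOpens.set (DOpC.Hom.toHom (algebraMap f) U) = Hom.toFun f ⁻¹' U.set :=
  RegularOpens.set_preimageHom (Hom.isOpenMap f) (Hom.continuous f) U

/-- The contravariant functor sending a compact space to its algebra of regular open sets. -/
def algebraFunctor : OpC.{u}ᵒᵖ ⥤ DOpC.{u} where
  obj X := X.unop.algebra
  map f := algebraMap f.unop
  map_id X := DOpC.hom_ext (DFunLike.ext _ _ fun U =>
    RegularOpens.set_injective (set_algebraMap (𝟙 X.unop) U))
  map_comp f g := DOpC.hom_ext (DFunLike.ext _ _ fun U =>
    RegularOpens.set_injective ((set_algebraMap (g.unop ≫ f.unop) U).trans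
      ((set_algebraMap g.unop (DOpC.Hom.toHom (algebraMap f.unop) U)).trans
        (congrArg _ (set_algebraMap f.unop U))).symm))

instance : algebraFunctor.{u}.Faithful where
  map_injective {X Y} f g hfg := Quiver.Hom.unop_inj (hom_ext (RegularOpens.eq_of_preimage_eq
    fun U => by
      rw [← set_algebraMap f.unop U, ← set_algebraMap g.unop U]
      exact congrArg (fun k => RegularOpens.set (DOpC.Hom.toHom k U)) hfg))

/-- Compactness makes both boundedness conditions automatic; the openness condition differs from the
local one only by symmetry of contact. -/
instance : algebraFunctor.{u}.Full where
  map_surjective {X Y} φ := by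
    obtain ⟨f, ho, hp, hf⟩ := RegularOpens.exists_isOpenMap_isProperMap
      (DOpC.Hom.rel_of_rel_map φ) (fun _ _ => isClosed_closure.isCompact)
      (fun _ _ => isClosed_closure.isCompact)
      (fun U V _ h => RegularOpens.isContactAlgebra.symm _ _
        (DOpC.Hom.openness φ U V (RegularOpens.isContactAlgebra.symm _ _ h)))
    let F : Y.unop ⟶ X.unop := Hom.mk (X := Y.unop) (Y := X.unop) f hp.continuous ho
    exact ⟨F.op, DOpC.hom_ext (DFunLike.ext _ _ fun U =>
      RegularOpens.set_injective ((set_algebraMap F U).trans (hf U)))⟩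

theorem exists_iso_algebra (A : DOpC.{u}) : ∃ X : OpC.{u}, Nonempty (X.algebra ≅ A) ∧
    (IsConnectedContact A.rel → PreconnectedSpace X) := by
  have h := isLocalContactAlgebra_top_iff.2 A.isNormalContactAlgebra
  have := ContactEnd.t2Space (ρ := A.rel) (I := ⊤)
  have := ContactEnd.compactSpace h
  refine ⟨⟨ContactEnd A.rel ⊤⟩, ⟨(DOpC.isoOfOrderIso (B := algebra ⟨ContactEnd A.rel ⊤⟩)
    (ContactEnd.regularOpensIso h) (ContactEnd.contact_regularOpensIso h)).symm⟩, ?_⟩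
  exact ContactEnd.preconnectedSpace h

end OpC

theorem theorem3p3 :
    Nonempty (OpPerLCCon.{u}ᵒᵖ ≌ DOpPerLCCon.{u}) ∧
      Nonempty (OpCCon.{u}ᵒᵖ ≌ DOpCCon.{u}) :=
  ⟨nonempty_equivalence_fullSubcategory OpPerLC.algebraFunctor
      (fun _ hX => RegularOpens.isConnectedContact_iff.2 hX) fun A hA =>
        (OpPerLC.exists_iso_algebra A).imp fun _ h => ⟨h.2 hA, h.1⟩,
    nonempty_equivalence_fullSubcategory OpC.algebraFunctor
      (fun _ hX => RegularOpens.isConnectedContact_iff.2 hX) fun A hA =>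
        (OpC.exists_iso_algebra A).imp fun _ h => ⟨h.2 hA, h.1⟩⟩
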